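/- Let $K$ be a field of characteristic $3$ and let $\theta$ be a Tits endomorphism of $K$, i.e. a ring endomorphism with $\theta(\theta(x)) = x^3$ for all $x\in K$; write $x^{\theta}=\theta(x)$, $x^{m\theta+n}=\theta(x)^m x^n$. Let $\Xi$ be the group of all triples $(a,b,c)\in K^3$ with multiplication $$(a,b,c)*(x,y,z) = (a+x,\; b+y+ax^\theta,\; ay-bx+c+z-ax^{\theta+1}).$$ Let $P=\Xi\cup\{\infty\}$. The group $\Xi$ acts on $P$ by multiplication from the right on $\Xi$, fixing $\infty$. For $s\in K^\times$ let $\eta_s$ be the permutation of $P$ that fixes $\infty$ and maps $(a,b,c)$ to $(sa, s^{\theta+1}b, s^{\theta+2}c)$. Put $$N(a,b,c) = -ac^\theta+a^{\theta+1}b^\theta-a^{\theta+3}b-a^2b^2+b^{\theta+1}+c^2-a^{2\theta+4},$$ and let $\omega$ be the permutation of $P$ that interchanges $\infty$ and $(0,0,0)$ and maps every other $(a,b,c)$ to $$\frac{-1}{N(a,b,c)}\bigl(a^\theta b^\theta-c^\theta+ab^2+bc-a^{2\theta+3},\; a^2b-ac+b^\theta-a^{\theta+3},\; c\bigr).$$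 The Ree group $R$ is the group of permutations of $P$ generated by $\omega$ and $\Xi$, and $R_\infty$ is the stabilizer of $\infty$ in $R$. Permutations act from the right, so that $\alpha\beta$ means first $\alpha$, then $\beta$. An involution is an element of order $2$. Then the following hold. 1. The involutions in $R_\infty$ form a single (non-empty) conjugacy class under $\Xi$. 2. The involutions in $R_\infty$ are exactly the elements $\eta_{-1}\xi$ with $\xi=(a,-a^{\theta+1},c)\in\Xi$, $a,c\in K$. 3. The involutions in $R$ that fix at least one point of $P$ form a single conjugacy class in $R$. -/

import Mathlib

/-- A Tits endomorphism of a field of characteristic `3`: a square root of the Frobenius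
endomorphism `x ↦ x ^ 3`. -/
def IsTitsEndomorphism {K : Type*} [Field K] (θ : K →+* K) : Prop :=
  ∀ x : K, θ (θ x) = x ^ 3

/-- The underlying set `K × K × K` of the root group `Ξ = RU(K, θ)`. -/
@[ext]
structure RU {K : Type*} [Field K] (θ : K →+* K) where
  a : K
  b : K
  c : K

namespace RU

variable {K : Type*} [Field K] {θ : K →+* K}

instance : Mul (RU θ) :=
  ⟨fun p q => ⟨p.a + q.a, p.b + q.b + p.a * θ q.a,
    p.a * q.b - p.b * q.a + p.c + q.c - p.a * (θ q.a * q.a)⟩⟩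

instance : One (RU θ) := ⟨⟨0, 0, 0⟩⟩

instance : Inv (RU θ) := ⟨fun p => ⟨-p.a, θ p.a * p.a - p.b, -p.c⟩⟩

@[simp] theorem mul_a (p q : RU θ) : (p * q).a = p.a + q.a := rfl
@[simp] theorem mul_b (p q : RU θ) : (p * q).b = p.b + q.b + p.a * θ q.a := rfl
@[simp] theorem mul_c (p q : RU θ) :
    (p * q).c = p.a * q.b - p.b * q.a + p.c + q.c - p.a * (θ q.a * q.a) := rfl
@[simp] theorem one_a : (1 : RU θ).a = 0 := rfl
@[simp] theorem one_b : (1 : RU θ).b = 0 := rfl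
@[simp] theorem one_c : (1 : RU θ).c = 0 := rfl
@[simp] theorem inv_a (p : RU θ) : p⁻¹.a = -p.a := rfl
@[simp] theorem inv_b (p : RU θ) : p⁻¹.b = θ p.a * p.a - p.b := rfl
@[simp] theorem inv_c (p : RU θ) : p⁻¹.c = -p.c := rfl

/-- The group `Ξ = RU(K, θ)`. -/
instance : Group (RU θ) :=
  Group.ofLeftAxioms
    (by intro x y z; ext <;> simp <;> ring)
    (by intro x; ext <;> simp)
    (by intro x; ext <;> simp <;> ring)

/-- First coordinate of `-N(ξ) • ω(ξ)`. -/
def u (p : RU θ) : K :=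
  θ p.a * θ p.b - θ p.c + p.a * p.b ^ 2 + p.b * p.c - θ p.a ^ 2 * p.a ^ 3

/-- Second coordinate of `-N(ξ) • ω(ξ)`. -/
def v (p : RU θ) : K :=
  p.a ^ 2 * p.b - p.a * p.c + θ p.b - θ p.a * p.a ^ 3

/-- The norm `N(a, b, c)`. -/
def N (p : RU θ) : K :=
  -(p.a * θ p.c) + θ p.a * p.a * θ p.b - θ p.a * p.a ^ 3 * p.b - p.a ^ 2 * p.b ^ 2
    + θ p.b * p.b + p.c ^ 2 - θ p.a ^ 2 * p.a ^ 4

/-- The map `ω` on the non-trivial elements of `Ξ`. -/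
def omegaFun (p : RU θ) : RU θ := ⟨-1 / N p * u p, -1 / N p * v p, -1 / N p * p.c⟩

section tits

variable [CharP K 3]

theorem three_eq_zero (K : Type*) [Field K] [CharP K 3] : (3 : K) = 0 := by
  exact_mod_cast CharP.cast_eq_zero K 3

theorem N_eq (p : RU θ) : N p = p.a * u p + p.b * v p + p.c ^ 2 := by
  have h3 : (3 : K) = 0 := three_eq_zero K
  simp only [N, u, v]
  linear_combination (-p.a ^ 2 * p.b ^ 2) * h3

set_option maxRecDepth 100000 in
set_option maxHeartbeats 4000000 in
theorem key_v (hθ : IsTitsEndomorphism θ) (p : RU θ) :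
    u p ^ 2 * v p * θ (N p) + u p * p.c * N p * θ (N p) + θ (v p) * N p ^ 3
      + θ (u p) * u p ^ 3 = p.b * N p ^ 2 * θ (N p) := by
  obtain ⟨a, b, c⟩ := p
  simp only [N, u, v, map_add, map_sub, map_mul, map_pow, map_neg, hθ a, hθ b, hθ c]
  generalize θ a = A
  generalize θ b = B
  generalize θ c = C
  grind

set_option maxRecDepth 100000 in
set_option maxHeartbeats 4000000 in
theorem key_u (hθ : IsTitsEndomorphism θ) (p : RU θ) :
    θ (u p) * θ (v p) * N p ^ 3 + θ p.c * θ (N p) * N p ^ 3 - u p * v p ^ 2 * θ (N p) ^ 2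
      + v p * p.c * θ (N p) ^ 2 * N p + θ (u p) ^ 2 * u p ^ 3
      = -(p.a * N p ^ 2 * θ (N p) ^ 2) := by
  obtain ⟨a, b, c⟩ := p
  simp only [N, u, v, map_add, map_sub, map_mul, map_pow, map_neg, hθ a, hθ b, hθ c]
  generalize θ a = A
  generalize θ b = B
  generalize θ c = C
  grind

/-- The norm is anisotropic. -/
theorem eq_one_of_N_eq_zero (hθ : IsTitsEndomorphism θ) (p : RU θ) (hN : N p = 0) : p = 1 := by
  have h3 : (3 : K) = 0 := three_eq_zero K
  have hM : θ (N p) = 0 := by rw [hN, map_zero]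
  have hu : u p = 0 := by
    have h := key_u hθ p
    rw [hM, hN] at h
    have h' : θ (u p) ^ 2 * u p ^ 3 = 0 := by linear_combination h
    simpa using h'
  have hU : θ (u p) = 0 := by rw [hu, map_zero]
  have hq := N_eq p
  rw [hN, hu] at hq
  obtain ⟨a, b, c⟩ := p
  simp only [u, v, map_add, map_sub, map_mul, map_pow, hθ a, hθ b, hθ c] at hu hU hq
  have hd : (c + a * b) ^ 2 = -b * (θ b - a ^ 3 * θ a) := by
    linear_combination -hq + a * b * c * h3
  have h1 : -(θ b + a ^ 3 * θ a) * (b * (c + a * b)) =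
      a ^ 3 * b ^ 3 + θ a * (θ b - a ^ 3 * θ a) ^ 2 := by
    generalize θ a = A at *
    generalize θ b = B at *
    generalize θ c = C at *
    grind
  by_cases ha : a = 0
  · subst ha
    simp only [map_zero] at *
    have hbc : b = 0 ∨ c = 0 := by
      by_contra! h
      have : θ b * (b * c) = 0 := by linear_combination -h1
      simp [h.1, h.2] at this
    rcases hbc with rfl | rfl
    · have : c ^ 2 = 0 := by simpa using hd
      have hc : c = 0 := by simpa using this
      rw [hc]; rfl
    · have : b * θ b = 0 := by linear_combination hd
      have hb : b = 0 := by simpa using this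
      rw [hb]; rfl
  exfalso
  have hA : θ a ≠ 0 := by simpa using ha
  have hE : θ b - a ^ 3 * θ a ≠ 0 := by
    intro hE
    rw [hE] at hd h1
    have hd0 : c + a * b = 0 := by simpa using hd
    rw [hd0] at h1
    have hb : b = 0 := by
      have : a ^ 3 * b ^ 3 = 0 := by linear_combination -h1
      simpa [ha] using this
    subst hb
    simp [ha] at hE
  have hb0 : b ≠ 0 := by
    rintro rfl
    have hd0 : c + a * 0 = 0 := by simpa using hd
    rw [hd0] at h1
    have : θ a * (θ 0 - a ^ 3 * θ a) ^ 2 = 0 := by linear_combination -h1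
    simp [ha] at this
  -- both factors of the resulting equation lead to the same value of `θ b`
  have hB : θ b = a ^ 3 * θ a - a ^ 2 * b := by
    have hprod : ((c + a * b) ^ 3 - θ a * (θ b - a ^ 3 * θ a) ^ 2) *
        ((θ b - a ^ 3 * θ a) ^ 3 + a ^ 3 * (c + a * b) ^ 3) = 0 := by
      clear hu hU hq
      generalize hEE : θ b - a ^ 3 * θ a = E at *
      generalize c + a * b = d at *
      have hBB : θ b = E + a ^ 3 * θ a := by linear_combination hEE
      rw [hBB] at h1
      have hbE : b * E = -d ^ 2 := by linear_combination hd
      have h5 : -(E - a ^ 3 * θ a) * ((b * E) * d) * E ^ 2 =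
          a ^ 3 * (b * E) ^ 3 + θ a * E ^ 5 := by
        linear_combination E ^ 3 * h1 + E ^ 3 * a ^ 3 * θ a * b * d * h3
      rw [hbE] at h5
      linear_combination h5
    rcases mul_eq_zero.1 hprod with h | h
    · have hD : θ (c + a * b) = a * (b - a * θ a) ^ 2 := by
        apply θ.injective
        simp only [map_mul, map_add, map_sub, map_pow, hθ a, hθ b, hθ c]
        linear_combination h - (c * a ^ 2 * b ^ 2 + c ^ 2 * a * b) * h3
      have h6 := congrArg θ hd
      simp only [map_mul, map_sub, map_pow, map_neg, hθ a, hθ b, hD] at h6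
      have he : b - a * θ a ≠ 0 := by
        intro h0
        apply hE
        have := congrArg θ h0
        simp only [map_mul, map_sub, map_zero, hθ a] at this
        linear_combination this
      have h7 : (b - a * θ a) ^ 3 * (θ b - (a ^ 3 * θ a - a ^ 2 * b)) = 0 := by
        linear_combination h6 + (b * a ^ 2 * θ a ^ 2 * θ b - b ^ 2 * a * θ a * θ b) * h3
      have h8 := (mul_eq_zero.1 h7).resolve_left (pow_ne_zero _ he)
      linear_combination h8
    · have h6 : (θ b - a ^ 3 * θ a + a * (c + a * b)) ^ 3 = 0 := by
        linear_combination h + ((θ b - a ^ 3 * θ a) ^ 2 * (a * (c + a * b))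
          + (θ b - a ^ 3 * θ a) * (a * (c + a * b)) ^ 2) * h3
      have h7 : θ b - a ^ 3 * θ a + a * (c + a * b) = 0 := by simpa using h6
      have h8 : (c + a * b) * c = 0 := by
        linear_combination hd - b * h7
      have hd0 : c + a * b ≠ 0 := by
        intro h0
        rw [h0] at h7
        apply hE
        linear_combination h7
      have hc : c = 0 := (mul_eq_zero.1 h8).resolve_left hd0
      linear_combination h7 - a * hc
  have hc : c = 0 ∨ c = a * b := by
    have : c * (c - a * b) = 0 := by
      linear_combination hd - b * hB - a * b * c * h3
    rcases mul_eq_zero.1 this with h | h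
    · exact Or.inl h
    · exact Or.inr (by linear_combination h)
  have hB' := congrArg θ hB
  simp only [map_mul, map_sub, map_pow, hθ a, hθ b] at hB'
  have hb2 : b * (b - a * θ a) * (b + a * θ a) = 0 := by
    linear_combination hB' - θ a ^ 2 * hB
  rcases mul_eq_zero.1 hb2 with hb2 | hb2
  · rcases mul_eq_zero.1 hb2 with hb2 | hb2
    · exact hb0 hb2
    · have : θ b = 0 := by linear_combination hB - a ^ 2 * hb2
      exact hb0 (by simpa using this)
  · have hb : b = -(a * θ a) := by linear_combination hb2
    have hne : a ^ 3 * θ a ^ 2 ≠ 0 := by simp [ha]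
    rcases hc with rfl | rfl
    · simp only [map_zero] at hu
      apply hne
      rw [hB, hb] at hu
      grind
    · simp only [map_mul] at hu
      rw [hB, hb] at hu
      apply hne
      grind

theorem N_ne_zero (hθ : IsTitsEndomorphism θ) {p : RU θ} (hp : p ≠ 1) : N p ≠ 0 :=
  fun h => hp (eq_one_of_N_eq_zero hθ p h)

theorem u_omegaFun (hθ : IsTitsEndomorphism θ) {p : RU θ} (hp : p ≠ 1) :
    u (omegaFun p) = -p.a / N p := by
  have hN := N_ne_zero hθ hp
  have hM : θ (N p) ≠ 0 := by simpa using hN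
  have h := key_u hθ p
  simp only [omegaFun]
  rw [u]
  simp only [map_mul, map_div₀, map_neg, map_one]
  field_simp
  linear_combination h

theorem v_omegaFun (hθ : IsTitsEndomorphism θ) {p : RU θ} (hp : p ≠ 1) :
    v (omegaFun p) = -p.b / N p := by
  have hN := N_ne_zero hθ hp
  have hM : θ (N p) ≠ 0 := by simpa using hN
  have h := key_v hθ p
  simp only [omegaFun]
  rw [v]
  simp only [map_mul, map_div₀, map_neg, map_one]
  field_simp
  linear_combination -h

theorem N_omegaFun (hθ : IsTitsEndomorphism θ) {p : RU θ} (hp : p ≠ 1) :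
    N (omegaFun p) = 1 / N p := by
  have hN := N_ne_zero hθ hp
  rw [N_eq, u_omegaFun hθ hp, v_omegaFun hθ hp]
  simp only [omegaFun]
  field_simp
  linear_combination -N_eq p

theorem omegaFun_ne_one (hθ : IsTitsEndomorphism θ) {p : RU θ} (hp : p ≠ 1) :
    omegaFun p ≠ 1 := by
  intro h
  have h1 := N_omegaFun hθ hp
  rw [h] at h1
  have h2 : N (1 : RU θ) = 0 := by simp [N]
  rw [h2] at h1
  exact N_ne_zero hθ hp (by simpa using h1.symm)

theorem omegaFun_omegaFun (hθ : IsTitsEndomorphism θ) {p : RU θ} (hp : p ≠ 1) :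
    omegaFun (omegaFun p) = p := by
  have hN := N_ne_zero hθ hp
  have h1 : omegaFun (omegaFun p) = ⟨-1 / N (omegaFun p) * u (omegaFun p),
    -1 / N (omegaFun p) * v (omegaFun p), -1 / N (omegaFun p) * (-1 / N p * p.c)⟩ := rfl
  rw [h1, N_omegaFun hθ hp, u_omegaFun hθ hp, v_omegaFun hθ hp]
  ext <;> simp only [] <;> field_simp

end tits

/-- The point set `P = Ξ ∪ {∞}`, where `∞` is `none`. -/
abbrev Point {K : Type*} [Field K] (θ : K →+* K) : Type _ := Option (RU θ)

/-- The point `∞` of `P`. -/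
def infty : Point θ := none

/-- An element `ξ` of `Ξ` as a permutation of `P`: multiplication by `ξ` from the right on `Ξ`,
fixing `∞`. -/
def transl (ξ : RU θ) : Equiv.Perm (Point θ) := (Equiv.mulRight ξ).optionCongr

theorem transl_mul (ξ ζ : RU θ) : transl (ξ * ζ) = transl ζ * transl ξ := by
  ext1 x
  cases x <;> simp [transl, mul_assoc]

/-- The group `Ξ` as a group of permutations of `P`. -/
def Xi (θ : K →+* K) : Subgroup (Equiv.Perm (Point θ)) where
  carrier := Set.range transl
  mul_mem' := by
    rintro _ _ ⟨ξ, rfl⟩ ⟨ζ, rfl⟩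
    exact ⟨ζ * ξ, transl_mul ζ ξ⟩
  one_mem' := ⟨1, by ext1 x; cases x <;> simp [transl]⟩
  inv_mem' := by
    rintro _ ⟨ξ, rfl⟩
    refine ⟨ξ⁻¹, eq_inv_of_mul_eq_one_left ?_⟩
    rw [← transl_mul]
    ext1 x
    cases x <;> simp [transl]

/-- The automorphism `η_s` of `Ξ`, for `s ≠ 0`. -/
def etaAut (s : Kˣ) : MulAut (RU θ) where
  toFun p := ⟨s * p.a, θ s * s * p.b, θ s * s ^ 2 * p.c⟩
  invFun p := ⟨(s⁻¹ : Kˣ) * p.a, θ (s⁻¹ : Kˣ) * (s⁻¹ : Kˣ) * p.b,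
    θ (s⁻¹ : Kˣ) * (s⁻¹ : Kˣ) ^ 2 * p.c⟩
  left_inv p := by
    have hs : (s : K) ≠ 0 := s.ne_zero
    have hs' : θ (s : K) ≠ 0 := by simp
    ext <;> simp <;> field_simp
  right_inv p := by
    have hs : (s : K) ≠ 0 := s.ne_zero
    have hs' : θ (s : K) ≠ 0 := by simp
    ext <;> simp <;> field_simp
  map_mul' p q := by ext <;> simp <;> ring

/-- `η_s` as a permutation of `P`, fixing `∞`. -/
def eta (s : Kˣ) : Equiv.Perm (Point θ) := (etaAut s).toEquiv.optionCongr

open Classical in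
/-- The map `ω` on all of `P`; it swaps `∞` and `o = (0, 0, 0)`. -/
noncomputable def omegaPoint : Point θ → Point θ
  | none => some 1
  | some p => if p = 1 then none else some (omegaFun p)

theorem omegaPoint_involutive [CharP K 3] (hθ : IsTitsEndomorphism θ) :
    Function.Involutive (omegaPoint (θ := θ)) := by
  rintro (_ | p)
  · simp [omegaPoint]
  · by_cases hp : p = 1
    · simp [omegaPoint, hp]
    · simp [omegaPoint, hp, omegaFun_ne_one hθ hp, omegaFun_omegaFun hθ hp]

/-- `ω` as a permutation of `P`. -/
noncomputable def omega [CharP K 3] (hθ : IsTitsEndomorphism θ) : Equiv.Perm (Point θ) :=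
  (omegaPoint_involutive hθ).toPerm

/-- The Ree group: the group of permutations of `P` generated by `ω` and `Ξ`. -/
noncomputable def Ree [CharP K 3] (hθ : IsTitsEndomorphism θ) : Subgroup (Equiv.Perm (Point θ)) :=
  Subgroup.closure ({omega hθ} ∪ (Xi θ : Set (Equiv.Perm (Point θ))))

/-- The stabilizer `R_∞` of `∞` in the Ree group. -/
noncomputable def ReeInfty [CharP K 3] (hθ : IsTitsEndomorphism θ) :
    Subgroup (Equiv.Perm (Point θ)) :=
  Ree hθ ⊓ MulAction.stabilizer (Equiv.Perm (Point θ)) (infty : Point θ)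

end RU

/-- The involutions in a subgroup `G`. -/
def involutionsOf {A : Type*} [Group A] (G : Subgroup A) : Set A :=
  {g | g ∈ G ∧ g ≠ 1 ∧ g * g = 1}

/-- `S` is a single (non-empty) conjugacy class under the subgroup `H`. -/
def IsConjClassUnder {A : Type*} [Group A] (H : Subgroup A) (S : Set A) : Prop :=
  ∃ g ∈ S, S = {x | ∃ h ∈ H, x = h⁻¹ * g * h}

/-! Everything rests on the fact that an element of R fixing both ∞ and o = (0,0,0) is some η_s
(`exists_eq_eta`). Embed P in projective 6-space by `coords`, with ∞ going to the last basis vector.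
Then Ξ acts through unitriangular matrices T(q) and ω through an antidiagonal matrix Ω. The relation
Ω T(p) Ω = L Ω T(ω(p)) with L upper triangular yields a Bruhat decomposition, so elements fixing ∞
have upper triangular matrices; conjugation by Ω shows that those fixing o as well are diagonal. The
images of (1,0,0), (0,1,0) and (0,0,1) then leave a single parameter s.

Hence every element of R_∞ has the form η_s ξ. Being an involution forces s = ±1. If s = 1, then ξ =
1 because Ξ has no 2-torsion; if s = -1, then ξ has middle coordinate -a^{θ+1}. Conversely, η_{-1}
lies in R by an explicit word (`eta_neg_one_mem_Ree`), and all these involutions are Ξ-conjugates of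
η_{-1} (`exists_conj_eta_neg_one`). Since R is transitive on P, any fixed point can be moved to ∞,
which reduces the claim on R to the one on R_∞. -/

namespace RU

variable {K : Type*} [Field K] {θ : K →+* K}

/-! ### Embedding in projective 6-space and its matrices -/

/-- The image of an element of `Ξ` under the embedding of `P` into projective `6`-space. -/
def coords (p : RU θ) : Fin 7 → K := ![1, p.a, p.b, p.c, v p, u p, N p]

/-- The matrix through which right multiplication by `q` acts on `coords`. -/
def translMatrix (q : RU θ) : Matrix (Fin 7) (Fin 7) K :=
  !![1, q.a, q.b, q.c, v q, u q, N q;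
    0, 1, θ q.a, q.b - q.a * θ q.a, q.a * q.b - q.c - q.a ^ 2 * θ q.a,
      q.c * θ q.a - q.b ^ 2 + q.a * q.b * θ q.a,
      -θ q.c - θ q.a * θ q.b - q.b * q.c + q.a * q.c * θ q.a + q.a * q.b ^ 2
        + q.a ^ 2 * q.b * θ q.a + q.a ^ 3 * θ q.a ^ 2;
    0, 0, 1, -q.a, -q.a ^ 2, q.c + q.a * q.b,
      θ q.b + q.a * q.c + q.a ^ 2 * q.b - q.a ^ 3 * θ q.a;
    0, 0, 0, 1, -q.a, q.b, -q.c;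
    0, 0, 0, 0, 1, -θ q.a, q.b - q.a * θ q.a;
    0, 0, 0, 0, 0, 1, q.a;
    0, 0, 0, 0, 0, 0, 1]

/-- The matrix through which `ω` acts on `coords`. -/
def omegaMatrix (K : Type*) [Field K] : Matrix (Fin 7) (Fin 7) K :=
  !![0, 0, 0, 0, 0, 0, 1;
    0, 0, 0, 0, 0, -1, 0;
    0, 0, 0, 0, -1, 0, 0;
    0, 0, 0, -1, 0, 0, 0;
    0, 0, -1, 0, 0, 0, 0;
    0, -1, 0, 0, 0, 0, 0;
    1, 0, 0, 0, 0, 0, 0]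

theorem translMatrix_one : translMatrix (1 : RU θ) = 1 := by
  ext i j
  fin_cases i <;> fin_cases j <;> simp [translMatrix, u, v, N]

theorem omegaMatrix_mul_self : omegaMatrix K * omegaMatrix K = 1 := by
  ext i j
  fin_cases i <;> fin_cases j <;> simp [omegaMatrix, Matrix.mul_apply, Fin.sum_univ_succ]

section tits

variable [CharP K 3]

-- Row 0 is what makes right multiplication linear on `coords` (see `coords_mul`); the other rows
-- make the assignment multiplicative.
set_option maxHeartbeats 4000000 in
theorem translMatrix_mul (hθ : IsTitsEndomorphism θ) (p q : RU θ) :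
    translMatrix (p * q) = translMatrix p * translMatrix q := by
  have h3 : (3 : K) = 0 := three_eq_zero K
  obtain ⟨a, b, c⟩ := p
  obtain ⟨x, y, z⟩ := q
  ext i j
  fin_cases i <;> fin_cases j <;>
    simp [translMatrix, Matrix.mul_apply, Fin.sum_univ_succ, u, v, N, hθ _] <;>
    grind

end tits

/-! ### Orthogonality of the flags of p and ω(p) -/

/-- The bilinear form for which the flags of `p` and `ω(p)` are orthogonal. -/
def flagForm (x y : Fin 7 → K) : K :=
  x 0 * y 0 + x 1 * y 1 + x 2 * y 2 - x 3 * y 3 + x 4 * y 4 + x 5 * y 5 + x 6 * y 6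

theorem flagForm_comm (x y : Fin 7 → K) : flagForm x y = flagForm y x := by
  simp only [flagForm]
  ring

theorem translMatrix_zero (p : RU θ) : translMatrix p 0 = coords p := rfl

section tits

variable [CharP K 3]

/-- Orthogonality of rows 0 and 1 under `gramMatrix`, solved for the last entry; the next lemma does
the same for rows 0 and 2. In this form `u` and `v` can be evaluated at ω(p), where they are -a/N
and -b/N. -/
theorem translMatrix_one_six (q : RU θ) : translMatrix q 1 6 =
    q.a * translMatrix q 1 5 + q.b * translMatrix q 1 4 - q.c * translMatrix q 1 3
      + v q * θ q.a + u q := by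
  have h3 : (3 : K) = 0 := three_eq_zero K
  simp [translMatrix, u, v]
  grind

theorem translMatrix_two_six (q : RU θ) : translMatrix q 2 6 = v q - q.a * q.c := by
  have h3 : (3 : K) = 0 := three_eq_zero K
  simp [translMatrix, v]
  grind

set_option maxRecDepth 100000 in
set_option maxHeartbeats 4000000 in
theorem flagForm_one_one (hθ : IsTitsEndomorphism θ) {p : RU θ} (hp : p ≠ 1) :
    flagForm (translMatrix p 1) (translMatrix (omegaFun p) 1) = 0 := by
  have h3 : (3 : K) = 0 := three_eq_zero K
  have hN := N_ne_zero hθ hp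
  have hM : θ (N p) ≠ 0 := by simpa using hN
  simp only [flagForm, translMatrix_one_six (omegaFun p), u_omegaFun hθ hp, v_omegaFun hθ hp]
  simp [translMatrix, omegaFun]
  field_simp
  clear hN hM hp
  obtain ⟨a, b, c⟩ := p
  simp only [N, u, v, map_add, map_sub, map_mul, map_pow, map_neg, hθ a, hθ b, hθ c]
  generalize θ a = A
  generalize θ b = B
  generalize θ c = C
  grind

set_option maxRecDepth 100000 in
set_option maxHeartbeats 4000000 in
theorem flagForm_one_two (hθ : IsTitsEndomorphism θ) {p : RU θ} (hp : p ≠ 1) :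
    flagForm (translMatrix p 1) (translMatrix (omegaFun p) 2) = 0 := by
  have h3 : (3 : K) = 0 := three_eq_zero K
  have hN := N_ne_zero hθ hp
  have hM : θ (N p) ≠ 0 := by simpa using hN
  simp only [flagForm, translMatrix_two_six (omegaFun p), v_omegaFun hθ hp]
  simp [translMatrix, omegaFun]
  field_simp
  clear hN hM hp
  simp only [N, u, v]
  grind

set_option maxRecDepth 100000 in
set_option maxHeartbeats 4000000 in
theorem flagForm_one_three (hθ : IsTitsEndomorphism θ) {p : RU θ} (hp : p ≠ 1) :
    flagForm (translMatrix p 1) (translMatrix (omegaFun p) 3) = 0 := by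
  have h3 : (3 : K) = 0 := three_eq_zero K
  have hN := N_ne_zero hθ hp
  have hM : θ (N p) ≠ 0 := by simpa using hN
  simp only [flagForm]
  simp [translMatrix, omegaFun]
  field_simp
  clear hN hM hp
  simp only [N, u, v]
  grind

set_option maxRecDepth 100000 in
set_option maxHeartbeats 4000000 in
theorem flagForm_one_four (hθ : IsTitsEndomorphism θ) {p : RU θ} (hp : p ≠ 1) :
    flagForm (translMatrix p 1) (translMatrix (omegaFun p) 4) = 0 := by
  have h3 : (3 : K) = 0 := three_eq_zero K
  have hN := N_ne_zero hθ hp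
  have hM : θ (N p) ≠ 0 := by simpa using hN
  simp only [flagForm]
  simp [translMatrix, omegaFun]
  field_simp
  clear hN hM hp
  obtain ⟨a, b, c⟩ := p
  simp only [N, u, v, map_add, map_sub, map_mul, map_pow, map_neg, hθ a, hθ b, hθ c]
  generalize θ a = A
  generalize θ b = B
  generalize θ c = C
  grind

set_option maxRecDepth 100000 in
set_option maxHeartbeats 4000000 in
theorem flagForm_two_two (hθ : IsTitsEndomorphism θ) {p : RU θ} (hp : p ≠ 1) :
    flagForm (translMatrix p 2) (translMatrix (omegaFun p) 2) = 0 := by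
  have h3 : (3 : K) = 0 := three_eq_zero K
  have hN := N_ne_zero hθ hp
  have hM : θ (N p) ≠ 0 := by simpa using hN
  simp only [flagForm, translMatrix_two_six (omegaFun p), v_omegaFun hθ hp]
  simp [translMatrix, omegaFun]
  field_simp
  clear hN hM hp
  simp only [N, u, v]
  grind

set_option maxRecDepth 100000 in
set_option maxHeartbeats 4000000 in
theorem flagForm_two_three (hθ : IsTitsEndomorphism θ) {p : RU θ} (hp : p ≠ 1) :
    flagForm (translMatrix p 2) (translMatrix (omegaFun p) 3) = 0 := by
  have h3 : (3 : K) = 0 := three_eq_zero K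
  have hN := N_ne_zero hθ hp
  have hM : θ (N p) ≠ 0 := by simpa using hN
  simp only [flagForm]
  simp [translMatrix, omegaFun]
  field_simp
  clear hN hM hp
  simp only [N, u, v]
  grind

/-- Up to the factor 1/N(p), `coords (omegaFun p)` is `coords p` times Ω, so the claim is that row i
of T(p) is orthogonal to row 0 under `gramMatrix`. For i = 6 that product is 1. -/
theorem flagForm_coords_omegaFun (hθ : IsTitsEndomorphism θ) {p : RU θ} (hp : p ≠ 1)
    {i : Fin 7} (hi : i < 6) : flagForm (translMatrix p i) (coords (omegaFun p)) = 0 := by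
  have h3 : (3 : K) = 0 := three_eq_zero K
  have hN := N_ne_zero hθ hp
  have hc : coords (omegaFun p) = (N p)⁻¹ • ![N p, -u p, -v p, -p.c, -p.b, -p.a, 1] := by
    rw [coords, u_omegaFun hθ hp, v_omegaFun hθ hp, N_omegaFun hθ hp]
    ext j
    fin_cases j <;> simp [omegaFun] <;> field_simp
  rw [hc]
  have hs (x y : Fin 7 → K) (t : K) : flagForm x (t • y) = t * flagForm x y := by
    simp only [flagForm, Pi.smul_apply, smul_eq_mul]
    ring
  rw [hs, mul_eq_zero]
  right
  clear hs hc hN hp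
  fin_cases i
  pick_goal 7
  · simp at hi
  all_goals
    simp [flagForm, translMatrix, N, u, v]
    try grind

/-- Since `omegaFun` is an involution, row 0 is covered by the preceding lemma with p and ω(p)
exchanged. The pairs 1 ≤ i ≤ k with i + k < 6 are the six computed above. -/
theorem flagForm_omegaFun_of_le (hθ : IsTitsEndomorphism θ) {p : RU θ} (hp : p ≠ 1)
    {i k : Fin 7} (hik : (i : ℕ) + k < 6) (hle : i ≤ k) :
    flagForm (translMatrix p i) (translMatrix (omegaFun p) k) = 0 := by
  by_cases hi : i = 0
  · subst hi
    have h := flagForm_coords_omegaFun hθ (omegaFun_ne_one hθ hp) (i := k)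
      (by simp only [Fin.lt_def]; simp at hik ⊢; omega)
    rw [omegaFun_omegaFun hθ hp] at h
    rw [translMatrix_zero, flagForm_comm, h]
  · have hi' : i = 1 ∨ i = 2 := by omega
    rcases hi' with rfl | rfl
    · have hk : k = 1 ∨ k = 2 ∨ k = 3 ∨ k = 4 := by simp at hik; omega
      rcases hk with rfl | rfl | rfl | rfl
      · exact flagForm_one_one hθ hp
      · exact flagForm_one_two hθ hp
      · exact flagForm_one_three hθ hp
      · exact flagForm_one_four hθ hp
    · have hk : k = 2 ∨ k = 3 := by simp at hik; omega
      rcases hk with rfl | rfl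
      · exact flagForm_two_two hθ hp
      · exact flagForm_two_three hθ hp

theorem flagForm_omegaFun (hθ : IsTitsEndomorphism θ) {p : RU θ} (hp : p ≠ 1)
    {i k : Fin 7} (hik : (i : ℕ) + k < 6) :
    flagForm (translMatrix p i) (translMatrix (omegaFun p) k) = 0 := by
  rcases le_total i k with h | h
  · exact flagForm_omegaFun_of_le hθ hp hik h
  · have h1 := flagForm_omegaFun_of_le hθ (omegaFun_ne_one hθ hp) (i := k) (k := i) (by omega) h
    rw [omegaFun_omegaFun hθ hp] at h1
    rw [flagForm_comm, h1]

end tits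

/-! ### The invariant form and the relation for Ω T(p) Ω -/

/-- The Gram matrix of the symmetric bilinear form preserved by all `translMatrix q`. -/
def gramMatrix (K : Type*) [Field K] : Matrix (Fin 7) (Fin 7) K :=
  !![0, 0, 0, 0, 0, 0, 1;
    0, 0, 0, 0, 0, -1, 0;
    0, 0, 0, 0, -1, 0, 0;
    0, 0, 0, 1, 0, 0, 0;
    0, 0, -1, 0, 0, 0, 0;
    0, -1, 0, 0, 0, 0, 0;
    1, 0, 0, 0, 0, 0, 0]

/-- The product of `gramMatrix` and `omegaMatrix`, the Gram matrix of `flagForm`. -/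
def signMatrix (K : Type*) [Field K] : Matrix (Fin 7) (Fin 7) K :=
  Matrix.diagonal ![1, 1, 1, -1, 1, 1, 1]

theorem omegaMatrix_mul_apply (M : Matrix (Fin 7) (Fin 7) K) (i j : Fin 7) :
    (omegaMatrix K * M) i j = ![1, -1, -1, -1, -1, -1, 1] i * M i.rev j := by
  fin_cases i <;> simp [omegaMatrix, Matrix.mul_apply, Fin.sum_univ_succ]

theorem gramMatrix_mul_self : gramMatrix K * gramMatrix K = 1 := by
  ext i j
  fin_cases i <;> fin_cases j <;> simp [gramMatrix, Matrix.mul_apply, Fin.sum_univ_succ]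

theorem omegaMatrix_mul_signMatrix : omegaMatrix K * signMatrix K = gramMatrix K := by
  ext i j
  fin_cases i <;> fin_cases j <;>
    simp [gramMatrix, omegaMatrix, signMatrix]

theorem signMatrix_mul_omegaMatrix : signMatrix K * omegaMatrix K = gramMatrix K := by
  ext i j
  fin_cases i <;> fin_cases j <;>
    simp [gramMatrix, omegaMatrix, signMatrix]

theorem mul_signMatrix_mul_transpose_apply (A B : Matrix (Fin 7) (Fin 7) K) (i j : Fin 7) :
    (A * signMatrix K * B.transpose) i j = flagForm (A i) (B j) := by
  rw [signMatrix, Matrix.mul_apply]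
  simp [Matrix.mul_diagonal, Fin.sum_univ_succ, flagForm]
  ring

theorem mul_gramMatrix_mul_transpose_apply (A B : Matrix (Fin 7) (Fin 7) K) (i j : Fin 7) :
    (A * gramMatrix K * B.transpose) i j = A i 0 * B j 6 - A i 1 * B j 5 - A i 2 * B j 4
      + A i 3 * B j 3 - A i 4 * B j 2 - A i 5 * B j 1 + A i 6 * B j 0 := by
  simp [gramMatrix, Matrix.mul_apply, Fin.sum_univ_succ]
  ring

theorem blockTriangular_translMatrix (q : RU θ) : (translMatrix q).BlockTriangular id := by
  intro i j hij
  fin_cases i <;> fin_cases j <;> first | rfl | exact absurd hij (by decide)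

section tits

variable [CharP K 3]

set_option maxHeartbeats 4000000 in
theorem translMatrix_mul_gramMatrix_mul_transpose (q : RU θ) :
    translMatrix q * gramMatrix K * (translMatrix q).transpose = gramMatrix K := by
  have h3 : (3 : K) = 0 := three_eq_zero K
  ext i j
  rw [mul_gramMatrix_mul_transpose_apply]
  fin_cases i <;> fin_cases j <;> simp [translMatrix, gramMatrix, u, v, N] <;> grind

theorem gramMatrix_mul_transpose_mul_gramMatrix_mul_translMatrix (q : RU θ) :
    gramMatrix K * (translMatrix q).transpose * gramMatrix K * translMatrix q = 1 := by
  have h : translMatrix q * (gramMatrix K * (translMatrix q).transpose * gramMatrix K) = 1 := by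
    rw [← Matrix.mul_assoc, ← Matrix.mul_assoc, translMatrix_mul_gramMatrix_mul_transpose,
      gramMatrix_mul_self]
  exact mul_eq_one_comm.1 h

/-- Geometrically, Ω carries the flag of p to the flag of ω(p). These flags are self-dual for the
invariant form, so this is the vanishing of `flagForm` on rows i, k with i + k < 6. -/
theorem exists_omegaMatrix_mul_translMatrix_mul_omegaMatrix (hθ : IsTitsEndomorphism θ)
    {p : RU θ} (hp : p ≠ 1) : ∃ L : Matrix (Fin 7) (Fin 7) K, L.BlockTriangular id ∧
      omegaMatrix K * translMatrix p * omegaMatrix K =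
        L * omegaMatrix K * translMatrix (omegaFun p) := by
  -- Solving for L requires the inverse of T(ω(p)), which is G T(ω(p))ᵗ G for the Gram matrix G; ΩG
  -- and GΩ are both `signMatrix`. The left factor Ω reverses rows, so entries below the diagonal
  -- come from i + k < 6.
  refine ⟨omegaMatrix K * (translMatrix p * signMatrix K * (translMatrix (omegaFun p)).transpose)
    * signMatrix K, ?_, ?_⟩
  · intro i j hij
    rw [signMatrix, Matrix.mul_diagonal, ← signMatrix, omegaMatrix_mul_apply,
      mul_signMatrix_mul_transpose_apply, flagForm_omegaFun hθ hp]
    · simp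
    · simp only [Fin.val_rev]
      simp only [id, Fin.lt_def] at hij
      omega
  · have h := gramMatrix_mul_transpose_mul_gramMatrix_mul_translMatrix (omegaFun p)
    have h1 : signMatrix K = omegaMatrix K * gramMatrix K := by
      rw [← omegaMatrix_mul_signMatrix, ← Matrix.mul_assoc, omegaMatrix_mul_self, Matrix.one_mul]
    calc _ = omegaMatrix K * translMatrix p * omegaMatrix K * (gramMatrix K *
          (translMatrix (omegaFun p)).transpose * gramMatrix K * translMatrix (omegaFun p)) := by
          rw [h, Matrix.mul_one]
      _ = omegaMatrix K * (translMatrix p * (omegaMatrix K * gramMatrix K) *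
          (translMatrix (omegaFun p)).transpose) * gramMatrix K * translMatrix (omegaFun p) := by
          simp only [Matrix.mul_assoc]
      _ = _ := by
          rw [← h1, ← signMatrix_mul_omegaMatrix]
          simp only [Matrix.mul_assoc]

end tits

/-! ### Matrices of Ree group elements and Bruhat decomposition -/

/-- A vector spanning the point of projective `6`-space corresponding to a point of `P`. -/
def pointCoords : Point θ → Fin 7 → K
  | none => Pi.single 6 1
  | some p => coords p

@[simp] theorem transl_none (ξ : RU θ) : transl ξ none = none := rfl

@[simp] theorem transl_some (ξ p : RU θ) : transl ξ (some p) = some (p * ξ) := rfl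

@[simp] theorem eta_none (s : Kˣ) : eta (θ := θ) s none = none := rfl

@[simp] theorem eta_some (s : Kˣ) (p : RU θ) : eta s (some p) = some (etaAut s p) := rfl

theorem transl_one : transl (1 : RU θ) = 1 := by
  ext1 x
  cases x <;> simp

theorem transl_inv (ξ : RU θ) : (transl ξ)⁻¹ = transl ξ⁻¹ := by
  rw [inv_eq_iff_mul_eq_one, ← transl_mul, inv_mul_cancel, transl_one]

theorem transl_mem_Xi (ξ : RU θ) : transl ξ ∈ Xi θ := ⟨ξ, rfl⟩

theorem coords_vecMul_omegaMatrix (p : RU θ) : Matrix.vecMul (coords p) (omegaMatrix K) =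
    ![N p, -u p, -v p, -p.c, -p.b, -p.a, 1] := by
  ext j
  fin_cases j <;> simp [coords, omegaMatrix, Matrix.vecMul, dotProduct, Fin.sum_univ_succ]

theorem coords_one : coords (1 : RU θ) = Pi.single 0 1 := by
  ext j
  fin_cases j <;> simp [coords, u, v, N]

theorem single_zero_vecMul_omegaMatrix :
    Matrix.vecMul (Pi.single 0 1) (omegaMatrix K) = Pi.single 6 1 := by
  ext j
  fin_cases j <;> simp [omegaMatrix]

theorem single_six_vecMul_omegaMatrix :
    Matrix.vecMul (Pi.single 6 1) (omegaMatrix K) = Pi.single 0 1 := by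
  ext j
  fin_cases j <;> simp [omegaMatrix]

theorem single_six_vecMul {M : Matrix (Fin 7) (Fin 7) K} (hM : M.BlockTriangular id) :
    Matrix.vecMul (Pi.single 6 1) M = M 6 6 • Pi.single 6 1 := by
  ext j
  by_cases hj : j = 6
  · subst hj
    simp
  · have : M 6 j = 0 := hM (by simp only [id, Fin.lt_def]; simp; omega)
    simp [this, hj]

section tits

variable [CharP K 3]

theorem coords_mul (hθ : IsTitsEndomorphism θ) (p q : RU θ) :
    Matrix.vecMul (coords p) (translMatrix q) = coords (p * q) := by
  have h := congrFun (translMatrix_mul hθ p q) 0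
  rw [← translMatrix_zero, ← translMatrix_zero, h]
  rfl

theorem coords_omegaFun (hθ : IsTitsEndomorphism θ) {p : RU θ} (hp : p ≠ 1) :
    coords (omegaFun p) = (N p)⁻¹ • Matrix.vecMul (coords p) (omegaMatrix K) := by
  have hN := N_ne_zero hθ hp
  rw [coords_vecMul_omegaMatrix, coords, u_omegaFun hθ hp, v_omegaFun hθ hp, N_omegaFun hθ hp]
  ext j
  fin_cases j <;> simp [omegaFun] <;> field_simp

theorem omega_apply_some (hθ : IsTitsEndomorphism θ) {p : RU θ} (hp : p ≠ 1) :
    omega hθ (some p) = some (omegaFun p) := if_neg hp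

@[simp] theorem omega_apply_none (hθ : IsTitsEndomorphism θ) : omega hθ none = some 1 := rfl

@[simp] theorem omega_apply_one (hθ : IsTitsEndomorphism θ) : omega hθ (some 1) = none := if_pos rfl

theorem omega_mul_self (hθ : IsTitsEndomorphism θ) : omega hθ * omega hθ = 1 := by
  ext1 x
  exact omegaPoint_involutive hθ x

/-- `Represents hθ g M`: the pair `(g, M)` is a product of the pairs consisting of a generator of
the Ree group and its standard matrix. -/
inductive Represents (hθ : IsTitsEndomorphism θ) :
    Equiv.Perm (Point θ) → Matrix (Fin 7) (Fin 7) K → Prop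
  | one : Represents hθ 1 1
  | omega {g M} : Represents hθ g M → Represents hθ (omega hθ * g) (M * omegaMatrix K)
  | transl {g M} (ξ : RU θ) :
      Represents hθ g M → Represents hθ (transl ξ * g) (M * translMatrix ξ)

/-- Permutations compose as functions but matrices act on row vectors, so the order of the factors
is reversed. -/
theorem Represents.mul {hθ : IsTitsEndomorphism θ} {g h : Equiv.Perm (Point θ)}
    {M M' : Matrix (Fin 7) (Fin 7) K} (hg : Represents hθ g M) (hh : Represents hθ h M') :
    Represents hθ (h * g) (M * M') := by
  induction hh with
  | one => simpa using hg
  | omega _ ih =>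
    rw [mul_assoc, ← Matrix.mul_assoc]
    exact ih.omega
  | transl ξ _ ih =>
    rw [mul_assoc, ← Matrix.mul_assoc]
    exact ih.transl ξ

theorem exists_represents (hθ : IsTitsEndomorphism θ) {g : Equiv.Perm (Point θ)}
    (hg : g ∈ Ree hθ) : ∃ M, Represents hθ g M := by
  induction hg using Subgroup.closure_induction_left with
  | one => exact ⟨1, .one⟩
  | mul_left x hx y _ ih =>
    obtain ⟨M, hM⟩ := ih
    rcases hx with rfl | ⟨ξ, rfl⟩
    · exact ⟨_, hM.omega⟩
    · exact ⟨_, hM.transl ξ⟩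
  | inv_mul_cancel x hx y _ ih =>
    obtain ⟨M, hM⟩ := ih
    rcases hx with rfl | ⟨ξ, rfl⟩
    · rw [inv_eq_of_mul_eq_one_left (omega_mul_self hθ)]
      exact ⟨_, hM.omega⟩
    · rw [transl_inv]
      exact ⟨_, hM.transl ξ⁻¹⟩

theorem Represents.vecMul_pointCoords {hθ : IsTitsEndomorphism θ} {g : Equiv.Perm (Point θ)}
    {M : Matrix (Fin 7) (Fin 7) K} (hg : Represents hθ g M) (x : Point θ) :
    ∃ t : K, t ≠ 0 ∧ Matrix.vecMul (pointCoords x) M = t • pointCoords (g x) := by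
  induction hg with
  | one => exact ⟨1, one_ne_zero, by simp⟩
  | @omega g M _ ih =>
    obtain ⟨t, ht, h⟩ := ih
    rw [← Matrix.vecMul_vecMul, h, Matrix.smul_vecMul, Equiv.Perm.mul_apply]
    rcases g x with _ | p
    · exact ⟨t, ht, by
        rw [omega_apply_none, pointCoords, pointCoords, coords_one, single_six_vecMul_omegaMatrix]⟩
    · by_cases hp : p = 1
      · subst hp
        exact ⟨t, ht, by
          rw [omega_apply_one, pointCoords, pointCoords, coords_one,
            single_zero_vecMul_omegaMatrix]⟩
      · refine ⟨t * N p, mul_ne_zero ht (N_ne_zero hθ hp), ?_⟩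
        rw [omega_apply_some hθ hp, pointCoords, pointCoords, coords_omegaFun hθ hp, smul_smul,
          mul_assoc, mul_inv_cancel₀ (N_ne_zero hθ hp), mul_one]
  | @transl g M ξ _ ih =>
    obtain ⟨t, ht, h⟩ := ih
    rw [← Matrix.vecMul_vecMul, h, Matrix.smul_vecMul, Equiv.Perm.mul_apply]
    refine ⟨t, ht, ?_⟩
    rcases g x with _ | p
    · rw [transl_none, pointCoords, single_six_vecMul (blockTriangular_translMatrix ξ)]
      simp [translMatrix]
    · rw [transl_some, pointCoords, pointCoords, coords_mul hθ]

/-- The Bruhat decomposition of the matrices representing elements of the Ree group. -/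
theorem Represents.bruhat {hθ : IsTitsEndomorphism θ} {g : Equiv.Perm (Point θ)}
    {M : Matrix (Fin 7) (Fin 7) K} (hg : Represents hθ g M) :
    M.BlockTriangular id ∨ ∃ (L : Matrix (Fin 7) (Fin 7) K) (ξ : RU θ),
      L.BlockTriangular id ∧ M = L * omegaMatrix K * translMatrix ξ := by
  induction hg with
  | one => exact .inl Matrix.blockTriangular_one
  | omega _ ih =>
    rcases ih with h | ⟨L, ξ, hL, rfl⟩
    · exact .inr ⟨_, 1, h, by rw [translMatrix_one, Matrix.mul_one]⟩
    · by_cases hξ : ξ = 1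
      · left
        rwa [hξ, translMatrix_one, Matrix.mul_one, Matrix.mul_assoc, omegaMatrix_mul_self,
          Matrix.mul_one]
      · obtain ⟨L', hL', h⟩ := exists_omegaMatrix_mul_translMatrix_mul_omegaMatrix hθ hξ
        refine .inr ⟨L * L', omegaFun ξ, hL.mul hL', ?_⟩
        rw [Matrix.mul_assoc, Matrix.mul_assoc, ← Matrix.mul_assoc (omegaMatrix K), h]
        simp only [Matrix.mul_assoc]
  | transl ζ _ ih =>
    rcases ih with h | ⟨L, ξ, hL, rfl⟩
    · exact .inl (h.mul (blockTriangular_translMatrix ζ))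
    · exact .inr ⟨L, ξ * ζ, hL, by rw [Matrix.mul_assoc, translMatrix_mul hθ]⟩

/-- In the other Bruhat cell, the vector of ∞ goes to a multiple of `coords ξ`, whose coordinate 0
is nonzero, so ∞ would be moved. -/
theorem Represents.blockTriangular {hθ : IsTitsEndomorphism θ} {g : Equiv.Perm (Point θ)}
    {M : Matrix (Fin 7) (Fin 7) K} (hg : Represents hθ g M) (h : g none = none) :
    M.BlockTriangular id := by
  refine hg.bruhat.resolve_right ?_
  rintro ⟨L, ξ, hL, rfl⟩
  obtain ⟨t, ht, h1⟩ := hg.vecMul_pointCoords none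
  rw [h, pointCoords, ← Matrix.vecMul_vecMul, ← Matrix.vecMul_vecMul, single_six_vecMul hL,
    Matrix.smul_vecMul, single_six_vecMul_omegaMatrix, ← coords_one, Matrix.smul_vecMul,
    coords_mul hθ, one_mul] at h1
  have h0 := congrFun h1 0
  have h6 := congrFun h1 6
  simp [coords] at h0 h6
  rw [h0, zero_mul] at h6
  exact ht h6.symm

theorem Represents.apply_eq_zero {hθ : IsTitsEndomorphism θ} {g : Equiv.Perm (Point θ)}
    {M : Matrix (Fin 7) (Fin 7) K} (hg : Represents hθ g M) (h : g none = none)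
    (h1 : g (some 1) = some 1) {i j : Fin 7} (hij : i ≠ j) : M i j = 0 := by
  rcases lt_or_gt_of_ne hij with hlt | hlt
  · have hW : Represents hθ (RU.omega hθ) (omegaMatrix K) := by
      simpa using (Represents.one (hθ := hθ)).omega
    have hb := ((hW.mul hg).mul hW).blockTriangular (by simp [h1])
    have h0 := hb (i := i.rev) (j := j.rev) (by simpa using hlt)
    rw [Matrix.mul_assoc, omegaMatrix_mul_apply] at h0
    have hs : ![(1 : K), -1, -1, -1, -1, -1, 1] i.rev ≠ 0 := by
      generalize i.rev = k
      fin_cases k <;> simp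
    have h2 := (mul_eq_zero.1 h0).resolve_left hs
    rw [Fin.rev_rev] at h2
    have h3 : ∀ k : Fin 7, (M * omegaMatrix K) i k.rev = 0 → M i k = 0 := by
      intro k
      fin_cases k <;> simp [Matrix.mul_apply, omegaMatrix, Fin.sum_univ_succ, Fin.rev]
    exact h3 j h2
  · exact hg.blockTriangular h hlt

end tits

/-! ### Two-point stabilizer and involutions of R_∞ -/

theorem etaAut_neg_one (p : RU θ) : etaAut (-1) p = ⟨-p.a, p.b, -p.c⟩ := by
  ext <;> simp [etaAut]

section tits

variable [CharP K 3]

/-- The two-point stabilizer in the Ree group consists of the maps `η_s`. -/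
theorem exists_eq_eta (hθ : IsTitsEndomorphism θ) {g : Equiv.Perm (Point θ)} (hg : g ∈ Ree hθ)
    (h : g none = none) (h1 : g (some 1) = some 1) : ∃ s : Kˣ, g = eta s := by
  obtain ⟨M, hM⟩ := exists_represents hθ hg
  have hoff {i j : Fin 7} (hij : i ≠ j) : M i j = 0 := hM.apply_eq_zero h h1 hij
  have hvec (x : Fin 7 → K) (j : Fin 7) : Matrix.vecMul x M j = x j * M j j := by
    rw [Matrix.vecMul, dotProduct, Finset.sum_eq_single j]
    · intro i _ hij
      rw [hoff hij, mul_zero]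
    · simp
  have key (p : RU θ) : ∃ q : RU θ, g (some p) = some q ∧ M 0 0 ≠ 0 ∧
      ∀ j, coords p j * M j j = M 0 0 * coords q j := by
    obtain ⟨t, ht, hp⟩ := hM.vecMul_pointCoords (some p)
    rcases hq : g (some p) with _ | q
    · rw [← h] at hq
      exact absurd (g.injective hq) (by simp)
    · rw [hq, pointCoords, pointCoords] at hp
      have hj (j : Fin 7) : coords p j * M j j = t * coords q j := by
        have := congrFun hp j
        rwa [hvec] at this
      have h0 : M 0 0 = t := by simpa [coords] using hj 0
      subst h0
      exact ⟨q, rfl, ht, hj⟩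
  have hM0 : M 0 0 ≠ 0 := let ⟨_, _, h, _⟩ := key 1; h
  -- Normalizing by M 0 0 removes the projective scalar, because coordinate 0 of `coords` is 1.
  set r : Fin 7 → K := fun j => M j j / M 0 0 with hr
  have key' (p : RU θ) : ∃ q : RU θ, g (some p) = some q ∧
      ∀ j, coords q j = coords p j * r j := by
    obtain ⟨q, hq, _, hj⟩ := key p
    refine ⟨q, hq, fun j => ?_⟩
    rw [hr]
    field_simp
    linear_combination -hj j
  obtain ⟨q, hgq, hq⟩ := key' ⟨1, 0, 0⟩
  have ha := hq 1
  have hb := hq 2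
  have hc := hq 3
  have hv := hq 4
  have hu := hq 5
  obtain ⟨x, y, z⟩ := q
  simp [coords, u, v] at ha hb hc hv hu
  subst ha hb hc
  obtain ⟨q, hgq', hq⟩ := key' ⟨0, 1, 0⟩
  have ha' := hq 1
  have hb' := hq 2
  have hc' := hq 3
  have hv' := hq 4
  obtain ⟨x, y, z⟩ := q
  simp [coords, v] at ha' hb' hc' hv'
  subst ha' hb' hc'
  obtain ⟨q, hgq'', hq⟩ := key' ⟨0, 0, 1⟩
  have ha'' := hq 1
  have hb'' := hq 2
  have hc'' := hq 3
  have hu'' := hq 5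
  obtain ⟨x, y, z⟩ := q
  simp [coords, u] at ha'' hb'' hc'' hu''
  subst ha'' hb'' hc''
  simp at hv hu hv' hu''
  -- The entry r 4 is read off twice, from (1,0,0) and from (0,1,0); comparison gives θ(r 2) = θ(r
  -- 1) (r 1)³. The entry r 5 determines r 3 in the same way.
  have h2 : r 2 = θ (r 1) * r 1 := by
    apply θ.injective
    rw [map_mul, hθ]
    linear_combination hv' - hv
  have h3 : r 3 = θ (r 1) * r 1 ^ 2 := by
    apply θ.injective
    rw [map_mul, hθ, map_pow]
    linear_combination hu'' - hu
  have hr1 : r 1 ≠ 0 := by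
    intro h0
    rw [h0] at hgq
    have : g (some (⟨1, 0, 0⟩ : RU θ)) = g (some 1) := by
      rw [hgq, h1]
      rfl
    have := congrArg a (Option.some.inj (g.injective this))
    simp at this
  refine ⟨Units.mk0 (r 1) hr1, ?_⟩
  ext1 x
  rcases x with _ | p
  · rw [h, eta_none]
  · obtain ⟨q, hgp, hq⟩ := key' p
    rw [hgp, eta_some, Option.some_inj]
    have ha := hq 1
    have hb := hq 2
    have hc := hq 3
    simp only [coords] at ha hb hc
    simp [h2] at hb
    simp [h3] at hc
    simp at ha
    ext
    · simp [etaAut, ha, mul_comm]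
    · simp [etaAut, hb, mul_comm]
    · simp [etaAut, hc, mul_comm]

theorem transl_mem_Ree (hθ : IsTitsEndomorphism θ) (ξ : RU θ) : transl ξ ∈ Ree hθ :=
  Subgroup.subset_closure (.inr (transl_mem_Xi ξ))

theorem omega_mem_Ree (hθ : IsTitsEndomorphism θ) : omega hθ ∈ Ree hθ :=
  Subgroup.subset_closure (.inl rfl)

theorem Xi_le_Ree (hθ : IsTitsEndomorphism θ) : Xi θ ≤ Ree hθ := by
  rintro _ ⟨ξ, rfl⟩
  exact transl_mem_Ree hθ ξ

theorem mem_ReeInfty_iff (hθ : IsTitsEndomorphism θ) {g : Equiv.Perm (Point θ)} :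
    g ∈ ReeInfty hθ ↔ g ∈ Ree hθ ∧ g none = none := Iff.rfl

theorem neg_one_ne_one (K : Type*) [Field K] [CharP K 3] : (-1 : K) ≠ 1 := by
  intro h
  have : (1 : K) = 0 := by linear_combination h + three_eq_zero K
  exact one_ne_zero this

theorem eta_neg_one_mem_Ree (hθ : IsTitsEndomorphism θ) : eta (θ := θ) (-1) ∈ Ree hθ := by
  have h3 : (3 : K) = 0 := three_eq_zero K
  have hne {x y : K} : (⟨1, x, y⟩ : RU θ) ≠ 1 := fun h => one_ne_zero (congrArg a h)
  have w1 : omega hθ (some ⟨1, 0, 0⟩) = some ⟨-1, -1, 0⟩ := by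
    rw [omega_apply_some hθ hne]
    simp [omegaFun, N, u, v]
  have w2 : omega hθ (some ⟨1, -1, 0⟩) = some ⟨-1, 0, 0⟩ := by
    have hN : N (⟨1, -1, 0⟩ : RU θ) = -1 := by simp [N]
    have hu : u (⟨1, -1, 0⟩ : RU θ) = -1 := by simp [u]
    have hv : v (⟨1, -1, 0⟩ : RU θ) = 0 := by simp [v]; grind
    rw [omega_apply_some hθ hne, omegaFun, hN, hu, hv]
    simp
  have w3 : omega hθ (some ⟨1, 1, 0⟩) = some ⟨1, 1, 0⟩ := by
    have hN : N (⟨1, 1, 0⟩ : RU θ) = -1 := by simp [N]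
    have hu : u (⟨1, 1, 0⟩ : RU θ) = 1 := by simp [u]
    have hv : v (⟨1, 1, 0⟩ : RU θ) = 1 := by simp [v]
    rw [omega_apply_some hθ hne, omegaFun, hN, hu, hv]
    simp
  have m1 : (⟨-1, -1, 0⟩ * ⟨1, -1, 0⟩ : RU θ) = 1 := by
    ext <;> simp <;> grind
  have m2 : (⟨-1, 0, 0⟩ * ⟨1, 1, 0⟩ : RU θ) = 1 := by
    ext <;> simp
  have m3 : (⟨1, 1, 0⟩ * ⟨-1, 0, 0⟩ : RU θ) = 1 := by
    ext <;> simp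
  -- Read from the right, this word fixes ∞ and o and sends (1,0,0) to (-1,0,0); hence it is η_s
  -- with s = -1.
  let g := transl (⟨-1, 0, 0⟩ : RU θ) * omega hθ * transl (⟨1, 1, 0⟩ : RU θ) * omega hθ *
    transl (⟨1, -1, 0⟩ : RU θ) * omega hθ
  have hg : g ∈ Ree hθ := by
    have hω := omega_mem_Ree hθ
    have hτ := transl_mem_Ree hθ
    exact mul_mem (mul_mem (mul_mem (mul_mem (mul_mem (hτ _) hω) (hτ _)) hω) (hτ _)) hω
  obtain ⟨s, hs⟩ := exists_eq_eta hθ hg (by simp [g, w2, m2]) (by simp [g, w3, m3])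
  have h1 : g (some ⟨1, 0, 0⟩) = some ⟨-1, 0, 0⟩ := by simp [g, w1, m1]
  rw [hs, eta_some, Option.some_inj] at h1
  have h2 : (s : K) = -1 := by simpa [etaAut] using congrArg a h1
  have h4 : s = -1 := Units.ext (by simpa using h2)
  rwa [← h4, ← hs]

theorem exists_eq_eta_trans_transl (hθ : IsTitsEndomorphism θ) {g : Equiv.Perm (Point θ)}
    (hg : g ∈ ReeInfty hθ) : ∃ (s : Kˣ) (ξ : RU θ), g = (eta s).trans (transl ξ) := by
  obtain ⟨hR, h⟩ := (mem_ReeInfty_iff hθ).1 hg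
  rcases h1 : g (some 1) with _ | ξ
  · exact absurd (g.injective (h1.trans h.symm)) (by simp)
  · obtain ⟨s, hs⟩ := exists_eq_eta hθ (mul_mem (transl_mem_Ree hθ ξ⁻¹) hR) (by simp [h])
      (by simp [h1])
    refine ⟨s, ξ, ?_⟩
    have : g = transl ξ * (transl ξ⁻¹ * g) := by
      rw [← transl_inv, mul_inv_cancel_left]
    rw [this, hs]
    rfl

theorem involutionsOf_ReeInfty (hθ : IsTitsEndomorphism θ) : involutionsOf (ReeInfty hθ) =
    {g | ∃ a c : K, g = (eta (-1)).trans (transl ⟨a, -(θ a * a), c⟩)} := by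
  have h3 : (3 : K) = 0 := three_eq_zero K
  ext g
  constructor
  · rintro ⟨hg, hne, hsq⟩
    obtain ⟨s, ξ, rfl⟩ := exists_eq_eta_trans_transl hθ hg
    have key (p : RU θ) : etaAut s (etaAut s p * ξ) * ξ = p := by
      have := congrArg (fun f : Equiv.Perm (Point θ) => f (some p)) hsq
      simpa using this
    have hξ : etaAut s ξ * ξ = 1 := by simpa using key 1
    have hs : (s : K) ^ 2 = 1 := by
      have h1 := congrArg a (key ⟨1, 0, 0⟩)
      have h2 := congrArg a hξ
      simp [etaAut] at h1 h2
      linear_combination h1 - h2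
    obtain ⟨x, y, z⟩ := ξ
    rcases sq_eq_one_iff.1 hs with h1 | h1
    -- Here ξ² = 1, and since 2 = -1 is invertible the coordinates of ξ vanish one after another.
    · obtain rfl : s = 1 := Units.ext h1
      have ha := congrArg a hξ
      have hb := congrArg b hξ
      have hc := congrArg c hξ
      simp [etaAut] at ha hb hc
      have hx : x = 0 := by linear_combination x * h3 - ha
      subst hx
      have hy : y = 0 := by
        rw [map_zero] at hb
        linear_combination y * h3 - hb
      subst hy
      have hz : z = 0 := by
        rw [map_zero] at hc
        linear_combination z * h3 - hc
      subst hz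
      refine absurd ?_ hne
      ext1 p
      rcases p with _ | p
      · rfl
      · have hp : p * ⟨0, 0, 0⟩ = p := mul_one p
        simpa [etaAut] using hp
    -- The middle coordinate of η_{-1}(ξ) ξ = 1 reads 2y = x θ(x), and 2 = -1.
    · obtain rfl : s = -1 := Units.ext (by simpa using h1)
      have hb := congrArg b hξ
      simp [etaAut_neg_one] at hb
      have hy : y = -(θ x * x) := by linear_combination y * h3 - hb
      exact ⟨x, z, by rw [hy]⟩
  · rintro ⟨x, z, rfl⟩
    refine ⟨(mem_ReeInfty_iff hθ).2 ⟨mul_mem (transl_mem_Ree hθ _) (eta_neg_one_mem_Ree hθ), rfl⟩,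
      ?_, ?_⟩
    · intro h
      have h1 := congrArg (fun f : Equiv.Perm (Point θ) => f (some ⟨1, 0, 0⟩)) h
      have h2 := congrArg (fun f : Equiv.Perm (Point θ) => f (some 1)) h
      simp at h2
      simp [etaAut_neg_one] at h1
      rw [h2, mul_one] at h1
      exact neg_one_ne_one K (congrArg a h1)
    · ext1 x
      rcases x with _ | p
      · rfl
      · simp [etaAut_neg_one]
        ext <;> simp <;> grind

end tits

end RU

/-! ### Conjugacy classes of involutions -/

theorem isConjClassUnder_of_forall {A : Type*} [Group A] {H : Subgroup A} {S : Set A} {g : A}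
    (hg : g ∈ S) (hS : ∀ x ∈ S, ∀ h ∈ H, h⁻¹ * x * h ∈ S)
    (h : ∀ x ∈ S, ∃ h ∈ H, x = h⁻¹ * g * h) : IsConjClassUnder H S :=
  ⟨g, hg, Set.Subset.antisymm h (by rintro _ ⟨k, hk, rfl⟩; exact hS g hg k hk)⟩

theorem conj_mem_involutionsOf {A : Type*} [Group A] {G : Subgroup A} {g h : A}
    (hg : g ∈ involutionsOf G) (hh : h ∈ G) : h⁻¹ * g * h ∈ involutionsOf G := by
  obtain ⟨h1, h2, h3⟩ := hg
  refine ⟨mul_mem (mul_mem (inv_mem hh) h1) hh, fun h4 => h2 ?_, ?_⟩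
  · have : g = h * (h⁻¹ * g * h) * h⁻¹ := by group
    rw [this, h4]
    group
  · have : h⁻¹ * g * h * (h⁻¹ * g * h) = h⁻¹ * (g * g) * h := by group
    rw [this, h3]
    group

namespace RU

variable {K : Type*} [Field K] {θ : K →+* K}

section tits

variable [CharP K 3]

theorem Xi_le_ReeInfty (hθ : IsTitsEndomorphism θ) : Xi θ ≤ ReeInfty hθ := by
  rintro _ ⟨ξ, rfl⟩
  exact (mem_ReeInfty_iff hθ).2 ⟨transl_mem_Ree hθ ξ, rfl⟩

theorem eta_neg_one_mem_involutionsOf (hθ : IsTitsEndomorphism θ) :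
    eta (-1) ∈ involutionsOf (ReeInfty hθ) := by
  rw [involutionsOf_ReeInfty]
  refine ⟨0, 0, ?_⟩
  have : (⟨0, -(θ 0 * 0), 0⟩ : RU θ) = 1 := by ext <;> simp
  rw [this, transl_one]
  rfl

theorem exists_conj_eta_neg_one (hθ : IsTitsEndomorphism θ) {g : Equiv.Perm (Point θ)}
    (hg : g ∈ involutionsOf (ReeInfty hθ)) : ∃ h ∈ Xi θ, g = h⁻¹ * eta (-1) * h := by
  have h3 : (3 : K) = 0 := three_eq_zero K
  rw [involutionsOf_ReeInfty] at hg
  obtain ⟨x, z, rfl⟩ := hg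
  -- Conjugating by ζ⁻¹ turns η_{-1} into η_{-1} followed by η_{-1}(ζ⁻¹) ζ. The witness ζ solves
  -- η_{-1}(ζ⁻¹) ζ = ξ with middle coordinate 0, using 2 = -1.
  refine ⟨transl (⟨-x, 0, -z - x ^ 2 * θ x⟩ : RU θ)⁻¹, transl_mem_Xi _, ?_⟩
  rw [transl_inv, inv_inv]
  ext1 p
  rcases p with _ | p
  · rfl
  · simp only [Equiv.trans_apply, Equiv.Perm.mul_apply, transl_some, eta_some, map_mul,
      mul_assoc, Option.some_inj, mul_right_inj]
    simp only [etaAut_neg_one]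
    ext <;> simp <;> grind

theorem isConjClassUnder_involutionsOf_ReeInfty (hθ : IsTitsEndomorphism θ) :
    IsConjClassUnder (Xi θ) (involutionsOf (ReeInfty hθ)) :=
  isConjClassUnder_of_forall (eta_neg_one_mem_involutionsOf hθ)
    (fun _ hx _ hh => conj_mem_involutionsOf hx (Xi_le_ReeInfty hθ hh))
    fun _ hx => exists_conj_eta_neg_one hθ hx

/-- Transitivity of R on P: ω takes ∞ to o, and Ξ is transitive on the points other than ∞. -/
theorem exists_mem_Ree_apply_none (hθ : IsTitsEndomorphism θ) (x : Point θ) :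
    ∃ h ∈ Ree hθ, h none = x := by
  rcases x with _ | p
  · exact ⟨1, one_mem _, rfl⟩
  · exact ⟨transl p * omega hθ, mul_mem (transl_mem_Ree hθ p) (omega_mem_Ree hθ), by simp⟩

theorem isConjClassUnder_involutionsOf_Ree (hθ : IsTitsEndomorphism θ) :
    IsConjClassUnder (Ree hθ) {g | g ∈ involutionsOf (Ree hθ) ∧ ∃ p, g p = p} := by
  obtain ⟨h1, h2⟩ := eta_neg_one_mem_involutionsOf hθ
  refine isConjClassUnder_of_forall (g := eta (-1)) ⟨⟨h1.1, h2⟩, none, rfl⟩ ?_ ?_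
  · rintro g ⟨hg, p, hp⟩ h hh
    exact ⟨conj_mem_involutionsOf hg hh, h⁻¹ p, by simp [hp]⟩
  · rintro g ⟨hg, p, hp⟩
    obtain ⟨k, hk, rfl⟩ := exists_mem_Ree_apply_none hθ p
    have hgk := conj_mem_involutionsOf hg hk
    obtain ⟨h, hh, he⟩ := exists_conj_eta_neg_one hθ
      (g := k⁻¹ * g * k) ⟨(mem_ReeInfty_iff hθ).2 ⟨hgk.1, by simp [hp]⟩, hgk.2⟩
    refine ⟨h * k⁻¹, mul_mem (Xi_le_Ree hθ hh) (inv_mem hk), ?_⟩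
    have : g = k * (k⁻¹ * g * k) * k⁻¹ := by group
    rw [this, he]
    group

end tits

end RU

theorem lemma4p1 {K : Type*} [Field K] [CharP K 3] (θ : K →+* K) (hθ : IsTitsEndomorphism θ) :
    -- the involutions in `R_∞` form a single conjugacy class under `Ξ`
    IsConjClassUnder (RU.Xi θ) (involutionsOf (RU.ReeInfty hθ)) ∧
    -- they are exactly the products `η_{-1} ξ` (first `η_{-1}`, then `ξ`), `ξ = (a, -a^{θ+1}, c)`
    involutionsOf (RU.ReeInfty hθ) =
      {g | ∃ a c : K, g = (RU.eta (-1)).trans (RU.transl ⟨a, -(θ a * a), c⟩)} ∧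
    -- the involutions in `R` with fixed points form a single conjugacy class in `R`
    IsConjClassUnder (RU.Ree hθ) {g | g ∈ involutionsOf (RU.Ree hθ) ∧ ∃ p, g p = p} :=
  ⟨RU.isConjClassUnder_involutionsOf_ReeInfty hθ, RU.involutionsOf_ReeInfty hθ,
    RU.isConjClassUnder_involutionsOf_Ree hθ⟩
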